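/- Let $d\in\mathbb N_0$, $\Omega=(\mathbb R\setminus\{0\})^d$, and write $xy=(x_1y_1,\dots,x_dy_d)$ and $1/x=(1/x_1,\dots,1/x_d)$ for $x,y\in\Omega$. Distributions are real- or complex-valued. Let $\mathcal D'_H(\Omega)$ be the set of all distributions $T\in\mathcal D'(\Omega)$ such that 1. for every test function $\varphi\in\mathcal D(\Omega)$ the function $y\mapsto T_x\varphi(xy)$, $y\in\Omega$, belongs to $\mathcal D(\Omega)$, and 2. for every compact $K\subset\Omega$ the set $(1/\operatorname{supp}T)\,K=\{(1/x)k : x\in\operatorname{supp}T,\ k\in K\}$ is relatively compact in $\Omega$, where $\operatorname{supp}T\subset\Omega$ is the support of $T$ in $\Omega$. Let $\mathcal E'(\Omega)$ be the set of all $T\in\mathcal D'(\Omega)$ with compact support in $\Omega$. Then $$\mathcal D'_H(\Omega)=\mathcal E'(\Omega).$$ Moreover, condition 1 alone already implies $T\in\mathcal E'(\Omega)$. -/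

import Mathlib

open scoped Distributions

noncomputable section

namespace MulConv

/-- The open set `(ℝ ∖ {0})^d` of all points of `ℝ^d` off the coordinate hyperplanes. Products,
inverses and the unit `1 = (1, …, 1)` in `Fin d → ℝ` are coordinatewise. -/
def nonzeroReals (d : ℕ) : TopologicalSpace.Opens (Fin d → ℝ) where
  carrier := {x | ∀ i, x i ≠ 0}
  is_open' := by
    simp only [Set.ofPred_forall]
    exact isOpen_iInter_of_finite fun i => isOpen_ne_fun (continuous_apply i) continuous_const

/-- The invertible dilation `x ↦ x y`, for `y ∈ (ℝ ∖ {0})^d`, as a homeomorphism of `ℝ^d`. -/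
def dilationHomeo {d : ℕ} (y : nonzeroReals d) : (Fin d → ℝ) ≃ₜ (Fin d → ℝ) where
  toFun x := x * (y : Fin d → ℝ)
  invFun x := x * (y : Fin d → ℝ)⁻¹
  left_inv x := by
    ext i
    have := y.2 i
    simp [this]
  right_inv x := by
    ext i
    have := y.2 i
    simp [this]
  continuous_toFun := by fun_prop
  continuous_invFun := by fun_prop

/-- For `y ∈ (ℝ ∖ {0})^d` and a test function `φ` on `(ℝ ∖ {0})^d`, the test function
`x ↦ φ (x y)` on `(ℝ ∖ {0})^d`. -/
def dilate {d : ℕ} (y : nonzeroReals d) (φ : 𝓓(nonzeroReals d, ℝ)) : 𝓓(nonzeroReals d, ℝ) where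
  toFun x := φ (x * (y : Fin d → ℝ))
  contDiff' := φ.contDiff.comp (contDiff_id.mul contDiff_const)
  hasCompactSupport' := φ.hasCompactSupport.comp_homeomorph (dilationHomeo y)
  tsupport_subset' := by
    intro x hx i hi
    have h : x * (y : Fin d → ℝ) ∈ tsupport φ :=
      tsupport_comp_subset_preimage φ (dilationHomeo y).continuous hx
    exact φ.tsupport_subset h i (by simp [hi])

/-- The support of a distribution on `(ℝ ∖ {0})^d`, as a relatively closed subset of
`(ℝ ∖ {0})^d`: the points of `(ℝ ∖ {0})^d` without a neighbourhood on which `T` vanishes.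
(`Distribution.dsupport` takes the closed support in the whole of `ℝ^d`, which can contain points
of the coordinate hyperplanes.) -/
def support {𝕜 : Type*} [RCLike 𝕜] {d : ℕ} (T : 𝓓'(nonzeroReals d, 𝕜)) : Set (Fin d → ℝ) :=
  Distribution.dsupport T ∩ nonzeroReals d

/-- The space `𝓔'((ℝ ∖ {0})^d)` of distributions on `(ℝ ∖ {0})^d` with compact support. -/
def compactlySupported (𝕜 : Type*) [RCLike 𝕜] (d : ℕ) : Set 𝓓'(nonzeroReals d, 𝕜) :=
  {T | IsCompact (support T)}

/-- `y ↦ T_x φ(x y)` is a test function on `(ℝ ∖ {0})^d` for every test function `φ` on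
`(ℝ ∖ {0})^d`. (As for distributions in Mathlib, `T` is applied to real-valued `φ`; for complex
`T` the condition for complex-valued `φ` follows by linearity.) -/
def PreservesTestFunctions {𝕜 : Type*} [RCLike 𝕜] {d : ℕ} (T : 𝓓'(nonzeroReals d, 𝕜)) : Prop :=
  ∀ φ : 𝓓(nonzeroReals d, ℝ), ∃ ψ : 𝓓(nonzeroReals d, 𝕜),
    ∀ y : nonzeroReals d, ψ (y : Fin d → ℝ) = T (dilate y φ)

/-- `A ⊂⊂ Ω`: the set `A` is relatively compact in `Ω`. -/
def IsRelativelyCompactIn {X : Type*} [TopologicalSpace X] (A Ω : Set X) : Prop :=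
  IsCompact (closure A) ∧ closure A ⊆ Ω

/-- The space `𝓓'_H(Ω)` for `Ω = (ℝ ∖ {0})^d`, which is its own closure `⋃ a Ω` under invertible
dilations: all `T ∈ 𝓓'(Ω)` such that `T_x φ(x ·) ∈ 𝓓(Ω)` for all `φ ∈ 𝓓(Ω)`, and
`(1 / supp T) K ⊂⊂ Ω` for every compact `K ⊆ Ω`. -/
def hadamardDistributions (𝕜 : Type*) [RCLike 𝕜] (d : ℕ) : Set 𝓓'(nonzeroReals d, 𝕜) :=
  {T | PreservesTestFunctions T ∧
    ∀ K : Set (Fin d → ℝ), IsCompact K → K ⊆ nonzeroReals d →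
      IsRelativelyCompactIn (Set.image2 (fun x k => x⁻¹ * k) (support T) K) (nonzeroReals d)}

end MulConv

end

/-!
*Condition 1 forces compact support.* The space of smooth functions supported in a compact set `B`
is a Fréchet space, hence a Baire space, so countably many non-zero continuous functionals on it are
simultaneously non-zero at one function. Let `B ⊆ Ω` be a compact neighbourhood of `(1, …, 1)` and
let `x_n ∈ supp T`. The functionals `g ↦ T (g (· / x_n))` are non-zero, because the dilates of `B`
to a neighbourhood of `x_n` carry test functions on which `T` does not vanish. A function `g` at
which all of them are non-zero produces a test function `ψ y = T_x g(x y)` with `ψ (1 / x_n) ≠ 0`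
for all `n`; so the points `1 / x_n` stay in a compact subset of `Ω`, and `x_n` has a limit point in
`supp T`.

*Compact support implies condition 1.* With a cutoff `η` equal to `1` near `supp T`, one has
`T_x φ(x y) = T_x (η(x) φ(x y))`. The functions `x ↦ η(x) φ(x y)` form a smooth family in `y`
supported in the fixed compact set `supp η`, so derivatives in `y` may be taken under `T`. For
`y` outside the compact set `(1 / supp η) supp φ` the function `x ↦ η(x) φ(x y)` vanishes.
-/

open TopologicalSpace Filter Topology Set
open scoped ContDiff BoundedContinuousFunction Uniformity

section Baire

open ContDiffMapSupportedIn

variable {E F : Type*} [NormedAddCommGroup E] [NormedSpace ℝ E]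
  [NormedAddCommGroup F] [NormedSpace ℝ F] {n : ℕ∞} {K : Compacts E}

theorem hasFTaylorSeriesUpTo_of_tendsto_structureMapCLM {ι : Type*} {l : Filter ι} [l.NeBot]
    {f : ι → 𝓓^{n}_{K}(E, F)} {p : ∀ i : ℕ, E →ᵇ (E [×i]→L[ℝ] F)}
    (hp : ∀ i, Tendsto (fun j => structureMapCLM ℝ n i (f j)) l (𝓝 (p i))) :
    HasFTaylorSeriesUpTo n (fun x => (p 0 x).curry0) fun x i => p i x where
  zero_eq _ := rfl
  cont i _ := (p i).continuous
  fderiv i hi x := by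
    have hlt : (i : ℕ∞) < n := mod_cast hi
    have hunif (i : ℕ) :=
      BoundedContinuousFunction.tendsto_iff_tendstoUniformly.1 (hp i)
    have hderiv : TendstoUniformly
        (fun j y => (structureMapCLM ℝ n (i + 1) (f j) y).curryLeft)
        (fun y => (p (i + 1) y).curryLeft) l :=
      (continuousMultilinearCurryLeftEquiv ℝ (fun _ : Fin (i + 1) => E) F).isometry
        |>.uniformContinuous.comp_tendstoUniformly (hunif (i + 1))
    refine hasFDerivAt_of_tendstoUniformly hderiv (fun j y => ?_)
      (fun y => (hunif i).tendsto_at y) x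
    simp only [structureMapCLM_apply, hlt.le, Order.add_one_le_of_lt hlt, Nat.cast_add,
      Nat.cast_one, if_true]
    exact (f j).contDiff.ftaylorSeries.fderiv i hi y

theorem isClosed_range_pi_structureMapCLM :
    IsClosed (range (ContinuousLinearMap.pi (structureMapCLM ℝ n) :
      𝓓^{n}_{K}(E, F) →L[ℝ] ∀ i : ℕ, E →ᵇ (E [×i]→L[ℝ] F))) := by
  refine IsSeqClosed.isClosed fun u p hu hup => ?_
  choose f hf using hu
  have hp (i : ℕ) : Tendsto (fun j => structureMapCLM ℝ n i (f j)) atTop (𝓝 (p i)) :=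
    (tendsto_pi_nhds.1 hup i).congr fun j => by rw [← hf j]; rfl
  have hp_apply (i : ℕ) (x : E) :
      Tendsto (fun j => structureMapCLM ℝ n i (f j) x) atTop (𝓝 (p i x)) :=
    (BoundedContinuousFunction.tendsto_iff_tendstoUniformly.1 (hp i)).tendsto_at x
  have htaylor := hasFTaylorSeriesUpTo_of_tendsto_structureMapCLM hp
  have hzero : EqOn (fun x => (p 0 x).curry0) 0 Kᶜ := fun x hx => by
    have : p 0 x = 0 := tendsto_nhds_unique (hp_apply 0 x) <| tendsto_const_nhds.congr fun j => by
      simp [structureMapCLM_apply, (f j).iteratedFDeriv_zero_on_compl (i := 0) hx]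
    simp [this]
  refine ⟨⟨_, htaylor.contDiff, hzero⟩, ?_⟩
  ext i x : 2
  by_cases hi : (i : ℕ∞) ≤ n
  · rw [ContinuousLinearMap.pi_apply, structureMapCLM_apply, if_pos hi]
    exact (htaylor.eq_iteratedFDeriv (mod_cast hi) x).symm
  · refine tendsto_nhds_unique (tendsto_const_nhds.congr fun j => ?_) (hp_apply i x)
    simp [structureMapCLM_apply, hi]

instance [CompleteSpace F] : CompleteSpace 𝓓^{n}_{K}(E, F) :=
  (completeSpace_iff_isComplete_range (isUniformEmbedding_pi_structureMapCLM ℝ).isUniformInducing).2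
    isClosed_range_pi_structureMapCLM.isComplete

instance [CompleteSpace F] : BaireSpace 𝓓^{n}_{K}(E, F) := by
  have : (𝓤 𝓓^{n}_{K}(E, F)).IsCountablyGenerated := by
    rw [← (isUniformEmbedding_pi_structureMapCLM ℝ).comap_uniformity]
    infer_instance
  infer_instance

theorem exists_forall_apply_ne_zero {𝕜 V W ι : Type*} [NontriviallyNormedField 𝕜]
    [AddCommGroup V] [Module 𝕜 V] [TopologicalSpace V] [ContinuousAdd V] [ContinuousSMul 𝕜 V]
    [BaireSpace V] [AddCommGroup W] [Module 𝕜 W] [TopologicalSpace W] [T1Space W] [Countable ι]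
    (Λ : ι → V →L[𝕜] W) (hΛ : ∀ i, Λ i ≠ 0) : ∃ v, ∀ i, Λ i v ≠ 0 := by
  by_contra! hcover
  obtain ⟨i, hi⟩ := nonempty_interior_of_iUnion_of_closed
    (f := fun i => ((Λ i).ker : Set V)) (fun i => (Λ i).isClosed_ker)
    (iUnion_eq_univ_iff.2 hcover)
  have hker : (Λ i).ker = ⊤ := Submodule.eq_top_of_nonempty_interior' _ hi
  exact hΛ i (ContinuousLinearMap.ext fun v => LinearMap.congr_fun (LinearMap.ker_eq_top.1 hker) v)

end Baire

section SmulTestFunction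

variable {E F : Type*} [NormedAddCommGroup E] [NormedSpace ℝ E] [NormedAddCommGroup F]
  [NormedSpace ℝ F] {Ω : Opens E} {n : ℕ∞} {ρ : E → ℝ}

/-- The product `ρ u` of a smooth function `ρ` and a test function `u`, which localizes `u`. -/
noncomputable def smulTestFunction (hρ : ContDiff ℝ n ρ) (u : 𝓓^{n}(Ω, F)) : 𝓓^{n}(Ω, F) where
  toFun := ρ • u
  contDiff' := hρ.smul u.contDiff
  hasCompactSupport' := u.hasCompactSupport.smul_left
  tsupport_subset' := (tsupport_smul_subset_right ρ u).trans u.tsupport_subset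

theorem tsupport_smulTestFunction_subset (hρ : ContDiff ℝ n ρ) (u : 𝓓^{n}(Ω, F)) {V : Set E}
    (hV : ∀ᶠ x in 𝓝ˢ (Vᶜ ∩ tsupport u), ρ x = 0) : tsupport (smulTestFunction hρ u) ⊆ V := by
  intro x hx
  by_contra hxV
  have hxu : x ∈ tsupport u := tsupport_smul_subset_right ρ u hx
  exact notMem_tsupport_iff_eventuallyEq.2 (eventually_nhdsSet_iff_forall.1 hV x ⟨hxV, hxu⟩)
    (tsupport_smul_subset_left ρ u hx)

end SmulTestFunction

section Support

open Distribution
open scoped Manifold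

variable {E : Type*} [NormedAddCommGroup E] [NormedSpace ℝ E] [FiniteDimensional ℝ E] {Ω : Opens E}

theorem exists_testFunction_one_nhdsSet {K : Set E} (hK : IsCompact K) (hKΩ : K ⊆ Ω) :
    ∃ η : 𝓓(Ω, ℝ), ∀ᶠ x in 𝓝ˢ K, η x = 1 := by
  obtain ⟨L, hL, hKL, hLΩ⟩ := exists_compact_between hK Ω.isOpen hKΩ
  obtain ⟨η, hη_one, hη_zero, -⟩ :=
    exists_contMDiffMap_one_nhds_of_subset_interior (n := ⊤) 𝓘(ℝ, E) hK.isClosed hKL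
  have hsupp : tsupport η ⊆ L :=
    closure_minimal (fun x hx => by_contra fun hxL => hx (hη_zero x hxL)) hL.isClosed
  exact ⟨⟨η, η.contMDiff.contDiff, hL.of_isClosed_subset (isClosed_tsupport _) hsupp,
    hsupp.trans hLΩ⟩, hη_one⟩

variable {F : Type*} [AddCommGroup F] [Module ℝ F] [TopologicalSpace F] {T : 𝓓'(Ω, F)}

theorem isVanishingOn_union {V W : Set E} (hV : IsVanishingOn T V) (hW : IsVanishingOn T W)
    (hVo : IsOpen V) (hWo : IsOpen W) : IsVanishingOn T (V ∪ W) := by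
  intro u hu
  obtain ⟨χ, hχ_zero, hχ_one, -⟩ := exists_contMDiffMap_zero_one_nhds_of_isClosed (n := ⊤) 𝓘(ℝ, E)
    (hVo.isClosed_compl.inter (isClosed_tsupport u))
    (hWo.isClosed_compl.inter (isClosed_tsupport u))
    (Set.disjoint_left.2 fun x hxV hxW => (hu hxV.2).elim hxV.1 hxW.1)
  have hχ : ContDiff ℝ ∞ χ := χ.contMDiff.contDiff
  have hχ' : ContDiff ℝ ∞ fun x => 1 - χ x := contDiff_const.sub hχ
  have hsplit : u = smulTestFunction hχ u + smulTestFunction hχ' u := by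
    ext x
    change u x = χ x * u x + (1 - χ x) * u x
    ring
  rw [hsplit, map_add, hV _ (tsupport_smulTestFunction_subset hχ u hχ_zero),
    hW _ (tsupport_smulTestFunction_subset hχ' u (hχ_one.mono fun x hx => by simp [hx])), add_zero]

theorem apply_eq_zero_of_disjoint_dsupport {u : 𝓓(Ω, ℝ)}
    (hu : Disjoint (tsupport u) (dsupport T)) : T u = 0 := by
  suffices ∃ V, IsOpen V ∧ tsupport u ⊆ V ∧ IsVanishingOn T V by
    obtain ⟨V, -, huV, hV⟩ := this
    exact hV u huV
  refine u.hasCompactSupport.induction_on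
    (p := fun s => ∃ V, IsOpen V ∧ s ⊆ V ∧ IsVanishingOn T V) ?empty ?mono ?union ?nhds
  case empty =>
    refine ⟨∅, isOpen_empty, subset_rfl, fun v hv => ?_⟩
    have hv_zero : v = 0 := DFunLike.coe_injective (tsupport_eq_empty_iff.1 (subset_empty_iff.1 hv))
    rw [hv_zero, map_zero]
  case mono =>
    rintro s t hst ⟨V, hVo, htV, hV⟩
    exact ⟨V, hVo, hst.trans htV, hV⟩
  case union =>
    rintro s t ⟨V, hVo, hsV, hV⟩ ⟨W, hWo, htW, hW⟩
    exact ⟨V ∪ W, hVo.union hWo, union_subset_union hsV htW, isVanishingOn_union hV hW hVo hWo⟩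
  case nhds =>
    intro x hx
    obtain ⟨V, hV, hVo, hxV⟩ := (notMem_dsupport_iff x).1 (Set.disjoint_left.1 hu hx)
    exact ⟨V, mem_nhdsWithin_of_mem_nhds (hVo.mem_nhds hxV), V, hVo, subset_rfl, hV⟩

theorem apply_eq_of_eventuallyEq_nhdsSet {u v : 𝓓(Ω, ℝ)}
    (huv : ∀ᶠ x in 𝓝ˢ (dsupport T ∩ Ω), u x = v x) : T u = T v := by
  rw [← sub_eq_zero, ← map_sub]
  refine apply_eq_zero_of_disjoint_dsupport (Set.disjoint_left.2 fun x hx hxT => ?_)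
  refine notMem_tsupport_iff_eventuallyEq.2 ?_ hx
  filter_upwards [eventually_nhdsSet_iff_forall.1 huv x ⟨hxT, (u - v).tsupport_subset hx⟩]
    with z hz using sub_eq_zero.2 hz

end Support

section Taylor

variable {V W : Type*} [NormedAddCommGroup V] [NormedSpace ℝ V]
  [NormedAddCommGroup W] [NormedSpace ℝ W] {f : V → W}

theorem fderiv_fderiv_apply_eq (hf : ContDiff ℝ 2 f) (w : V) :
    fderiv ℝ (fun p => fderiv ℝ f p w) = fun p => fderiv ℝ (fderiv ℝ f) p w := by
  funext p
  have hdf : Differentiable ℝ (fderiv ℝ f) :=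
    (hf.fderiv_right (m := 1) le_rfl).differentiable one_ne_zero
  have hsymm : IsSymmSndFDerivAt ℝ f p :=
    hf.contDiffAt.isSymmSndFDerivAt (by rw [minSmoothness_of_isRCLikeNormedField])
  ext v
  rw [fderiv_clm_apply (hdf p) (differentiableAt_const w)]
  simpa using hsymm.eq v w

theorem iteratedFDeriv_fderiv_apply_eq (hf : ContDiff ℝ ∞ f) (w : V) (i : ℕ) :
    iteratedFDeriv ℝ i (fun p => fderiv ℝ f p w) =
      fun p => fderiv ℝ (iteratedFDeriv ℝ i f) p w := by
  induction i with
  | zero =>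
    simp only [iteratedFDeriv_zero_eq_comp, LinearIsometryEquiv.comp_fderiv]
    rfl
  | succ i ih =>
    have hi : ContDiff ℝ 2 (iteratedFDeriv ℝ i f) :=
      (hf.iteratedFDeriv_right (m := ∞) le_rfl).of_le
        (WithTop.coe_le_coe.2 (le_top : (2 : ℕ∞) ≤ ⊤))
    have hDi : Differentiable ℝ (fderiv ℝ (iteratedFDeriv ℝ i f)) :=
      (hi.fderiv_right (m := 1) le_rfl).differentiable one_ne_zero
    have hsucc : Differentiable ℝ (iteratedFDeriv ℝ (i + 1) f) :=
      (hf.iteratedFDeriv_right (m := ∞) le_rfl).differentiable (by simp)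
    ext p v
    calc iteratedFDeriv ℝ (i + 1) (fun p => fderiv ℝ f p w) p v
        = fderiv ℝ (fderiv ℝ (iteratedFDeriv ℝ i f)) p w (v 0) (Fin.tail v) := by
          rw [iteratedFDeriv_succ_apply_left, ih, fderiv_fderiv_apply_eq hi]
      _ = fderiv ℝ (fun q => iteratedFDeriv ℝ (i + 1) f q v) p w := by
          simp only [iteratedFDeriv_succ_apply_left]
          rw [fderiv_continuousMultilinear_apply_const_apply
            ((hDi p).clm_apply (differentiableAt_const _)),
            fderiv_clm_apply (hDi p) (differentiableAt_const _)]
          simp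
      _ = fderiv ℝ (iteratedFDeriv ℝ (i + 1) f) p w v :=
          fderiv_continuousMultilinear_apply_const_apply (hsucc p) v w

theorem eventually_forall_norm_taylor_one_le (hf : ContDiff ℝ 1 f) {K : Set V} (hK : IsCompact K)
    {ε : ℝ} (hε : 0 < ε) :
    ∀ᶠ w in 𝓝 (0 : V), ∀ p ∈ K, ‖f (p + w) - f p - fderiv ℝ f p w‖ ≤ ε * ‖w‖ := by
  refine hK.eventually_forall_of_forall_eventually fun p₀ _ => ?_
  have hstrict : ∀ᶠ z : V × V in 𝓝 (0, p₀),
      ‖f (z.2 + z.1) - f z.2 - fderiv ℝ f p₀ z.1‖ ≤ ε / 2 * ‖z.1‖ := by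
    have hlim : Tendsto (fun z : V × V => (z.2 + z.1, z.2)) (𝓝 (0, p₀)) (𝓝 (p₀, p₀)) :=
      (show Continuous fun z : V × V => (z.2 + z.1, z.2) by fun_prop).tendsto' _ _ (by simp)
    filter_upwards [hlim.eventually
      ((hf.contDiffAt.hasStrictFDerivAt one_ne_zero).isLittleO.def (half_pos hε))] with z hz
    simpa using hz
  have hcont : ∀ᶠ z : V × V in 𝓝 (0, p₀), ‖fderiv ℝ f z.2 - fderiv ℝ f p₀‖ < ε / 2 := by
    have hlim : Tendsto (fun z : V × V => fderiv ℝ f z.2) (𝓝 (0, p₀)) (𝓝 (fderiv ℝ f p₀)) :=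
      ((hf.continuous_fderiv one_ne_zero).comp continuous_snd).tendsto (0, p₀)
    simpa [dist_eq_norm] using Metric.tendsto_nhds.1 hlim _ (half_pos hε)
  filter_upwards [hstrict, hcont] with ⟨w, p⟩ hfw hDf
  calc ‖f (p + w) - f p - fderiv ℝ f p w‖
      = ‖(f (p + w) - f p - fderiv ℝ f p₀ w) - (fderiv ℝ f p - fderiv ℝ f p₀) w‖ := by simp
    _ ≤ ε / 2 * ‖w‖ + ε / 2 * ‖w‖ :=
        (norm_sub_le _ _).trans (add_le_add hfw (ContinuousLinearMap.le_of_opNorm_le _ hDf.le w))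
    _ = ε * ‖w‖ := by ring

theorem iteratedFDeriv_taylor_one_remainder (hf : ContDiff ℝ ∞ f) (w p : V) (i : ℕ) :
    iteratedFDeriv ℝ i (fun q => f (q + w) - f q - fderiv ℝ f q w) p =
      iteratedFDeriv ℝ i f (p + w) - iteratedFDeriv ℝ i f p -
        fderiv ℝ (iteratedFDeriv ℝ i f) p w := by
  have htranslate : ContDiff ℝ ∞ fun q => f (q + w) := hf.comp (contDiff_id.add contDiff_const)
  have hderiv : ContDiff ℝ ∞ fun q => fderiv ℝ f q w :=
    (hf.fderiv_right le_rfl).clm_apply contDiff_const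
  have hle : (i : ℕ∞ω) ≤ ∞ := mod_cast le_top
  rw [fun_iteratedFDeriv_sub_apply ((htranslate.sub hf).of_le hle).contDiffAt
      (hderiv.of_le hle).contDiffAt,
    fun_iteratedFDeriv_sub_apply (htranslate.of_le hle).contDiffAt (hf.of_le hle).contDiffAt,
    iteratedFDeriv_comp_add_right, iteratedFDeriv_fderiv_apply_eq hf]

theorem norm_iteratedFDeriv_comp_prodMk_le {U : Type*} [NormedAddCommGroup U] [NormedSpace ℝ U]
    {f : U × V → W} {n : ℕ∞ω} (hf : ContDiff ℝ n f) (y : U) (x : V) {i : ℕ} (hi : i ≤ n) :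
    ‖iteratedFDeriv ℝ i (fun x => f (y, x)) x‖ ≤ ‖iteratedFDeriv ℝ i f (y, x)‖ := by
  have hshift : (fun x => f (y, x)) =
      (fun q => f (q + (y, 0))) ∘ ContinuousLinearMap.inr ℝ U V := by
    ext x
    simp
  have hsmooth : ContDiff ℝ n fun q => f (q + (y, 0)) :=
    hf.comp (contDiff_id.add contDiff_const)
  rw [hshift, ContinuousLinearMap.iteratedFDeriv_comp_right _ hsmooth x hi,
    iteratedFDeriv_comp_add_right]
  refine (ContinuousMultilinearMap.norm_compContinuousLinearMap_le _ _).trans ?_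
  have hbase : ContinuousLinearMap.inr ℝ U V x + (y, 0) = (y, x) := by simp
  rw [hbase]
  exact mul_le_of_le_one_right (norm_nonneg _) <| Finset.prod_le_one (fun _ _ => norm_nonneg _)
    fun _ _ => ContinuousLinearMap.norm_inr_le_one ℝ U V

end Taylor

section Family

variable {E E' F G : Type*} [NormedAddCommGroup E] [NormedSpace ℝ E] [NormedAddCommGroup E']
  [NormedSpace ℝ E'] [NormedAddCommGroup F] [NormedSpace ℝ F] [NormedAddCommGroup G]
  [NormedSpace ℝ G] {K : Compacts E} {Φ : E' → 𝓓_{K}(E, F)}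

theorem fderiv_uncurry_eq_zero_of_notMem (y : E') {x : E} (hx : x ∉ K) :
    fderiv ℝ (fun p : E' × E => Φ p.1 p.2) (y, x) = 0 := by
  have hzero : (fun p : E' × E => Φ p.1 p.2) =ᶠ[𝓝 (y, x)] fun _ => 0 := by
    filter_upwards [continuous_snd.continuousAt.preimage_mem_nhds
      (K.isCompact.isClosed.isOpen_compl.mem_nhds hx)] with p hp using (Φ p.1).zero_on_compl hp
  rw [hzero.fderiv_eq, fderiv_const_apply]

/-- The derivative at `y`, in the direction `h`, of a smoothly parametrized family `Φ` of functions
supported in `K`: the function `x ↦ ∂_h (Φ y x)`, with the derivative taken in `y`. -/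
noncomputable def paramDeriv (hΦ : ContDiff ℝ ∞ fun p : E' × E => Φ p.1 p.2) (y : E') :
    E' →ₗ[ℝ] 𝓓_{K}(E, F) where
  toFun h :=
    { toFun := fun x => fderiv ℝ (fun p : E' × E => Φ p.1 p.2) (y, x) (h, 0)
      contDiff' := ((hΦ.fderiv_right (m := ∞) le_rfl).comp
        (contDiff_prodMk_right y)).clm_apply contDiff_const
      zero_on_compl' := fun x hx => by simp [fderiv_uncurry_eq_zero_of_notMem y hx] }
  map_add' h₁ h₂ := by
    ext x
    simpa using! map_add (fderiv ℝ (fun p : E' × E => Φ p.1 p.2) (y, x)) (h₁, 0) (h₂, 0)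
  map_smul' c h := by
    ext x
    simpa using! map_smul (fderiv ℝ (fun p : E' × E => Φ p.1 p.2) (y, x)) c (h, 0)

theorem paramDeriv_apply (hΦ : ContDiff ℝ ∞ fun p : E' × E => Φ p.1 p.2) (y h : E') (x : E) :
    paramDeriv hΦ y h x = fderiv ℝ (fun p : E' × E => Φ p.1 p.2) (y, x) (h, 0) := rfl

theorem contDiff_uncurry_paramDeriv (hΦ : ContDiff ℝ ∞ fun p : E' × E => Φ p.1 p.2) (h : E') :
    ContDiff ℝ ∞ fun p : E' × E => paramDeriv hΦ p.1 h p.2 :=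
  (hΦ.fderiv_right (m := ∞) le_rfl).clm_apply contDiff_const

theorem isLittleO_seminorm_sub_paramDeriv (hΦ : ContDiff ℝ ∞ fun p : E' × E => Φ p.1 p.2)
    (y : E') (i : ℕ) :
    (fun h => N[ℝ]_{K, i} (Φ (y + h) - Φ y - paramDeriv hΦ y h)) =o[𝓝 0] fun h => h := by
  refine Asymptotics.IsLittleO.of_bound fun ε hε => ?_
  have hle : (i : ℕ∞ω) ≤ ∞ := mod_cast le_top
  set f : E' × E → F := fun p => Φ p.1 p.2 with hf
  have hDi : ContDiff ℝ 1 (iteratedFDeriv ℝ i f) :=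
    (hΦ.iteratedFDeriv_right (m := ∞) le_rfl).of_le
      (WithTop.coe_le_coe.2 (le_top : (1 : ℕ∞) ≤ ⊤))
  have hlim : Tendsto (fun h : E' => (h, (0 : E))) (𝓝 0) (𝓝 0) :=
    (show Continuous fun h : E' => (h, (0 : E)) by fun_prop).tendsto 0
  filter_upwards [hlim.eventually (eventually_forall_norm_taylor_one_le hDi
    (isCompact_singleton.prod K.isCompact : IsCompact ({y} ×ˢ (K : Set E))) hε)] with h hh
  rw [Real.norm_of_nonneg (apply_nonneg _ _),
    ContDiffMapSupportedIn.seminorm_top_le_iff ℝ (by positivity)]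
  intro x hx
  have hremainder : ContDiff ℝ ∞ fun q => f (q + (h, 0)) - f q - fderiv ℝ f q (h, 0) :=
    ((hΦ.comp (contDiff_id.add contDiff_const)).sub hΦ).sub
      ((hΦ.fderiv_right (m := ∞) le_rfl).clm_apply contDiff_const)
  calc ‖iteratedFDeriv ℝ i (Φ (y + h) - Φ y - paramDeriv hΦ y h) x‖
      = ‖iteratedFDeriv ℝ i
          (fun x => f ((y, x) + (h, 0)) - f (y, x) - fderiv ℝ f (y, x) (h, 0)) x‖ := by
        congr 2
        ext x
        simp [hf, paramDeriv_apply]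
    _ ≤ ‖iteratedFDeriv ℝ i (fun q => f (q + (h, 0)) - f q - fderiv ℝ f q (h, 0)) (y, x)‖ :=
        norm_iteratedFDeriv_comp_prodMk_le hremainder y x hle
    _ ≤ ε * ‖(h, (0 : E))‖ := by
        rw [iteratedFDeriv_taylor_one_remainder hΦ]
        exact hh (y, x) ⟨rfl, hx⟩
    _ = ε * ‖h‖ := by simp

theorem hasFDerivAt_apply_of_contDiff_uncurry [FiniteDimensional ℝ E']
    (T : 𝓓_{K}(E, F) →L[ℝ] G) (hΦ : ContDiff ℝ ∞ fun p : E' × E => Φ p.1 p.2) (y : E') :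
    HasFDerivAt (fun y => T (Φ y)) (T.toLinearMap ∘ₗ paramDeriv hΦ y).toContinuousLinearMap y := by
  obtain ⟨s, C, -, hT⟩ := Seminorm.bound_of_continuous
    (ContDiffMapSupportedIn.withSeminorms ℝ E F ⊤ K) ((normSeminorm ℝ G).comp T.toLinearMap)
    T.continuous.norm
  rw [hasFDerivAt_iff_isLittleO_nhds_zero]
  refine Asymptotics.IsBigO.trans_isLittleO (.of_bound C (.of_forall fun h => ?_))
    (Asymptotics.IsLittleO.fun_sum fun i (_ : i ∈ s) => isLittleO_seminorm_sub_paramDeriv hΦ y i)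
  have hsum := Seminorm.finset_sup_le_sum (ContDiffMapSupportedIn.seminorm ℝ E F ⊤ K) s
  calc ‖T (Φ (y + h)) - T (Φ y) - T (paramDeriv hΦ y h)‖
      = ‖T (Φ (y + h) - Φ y - paramDeriv hΦ y h)‖ := by simp only [map_sub]
    _ ≤ C * ∑ i ∈ s, N[ℝ]_{K, i} (Φ (y + h) - Φ y - paramDeriv hΦ y h) := by
        refine (hT _).trans (mul_le_mul_of_nonneg_left ((hsum _).trans_eq ?_) C.2)
        simp
    _ ≤ C * ‖∑ i ∈ s, N[ℝ]_{K, i} (Φ (y + h) - Φ y - paramDeriv hΦ y h)‖ :=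
        mul_le_mul_of_nonneg_left (Real.le_norm_self _) C.2

theorem contDiff_apply_of_contDiff_uncurry [FiniteDimensional ℝ E']
    (T : 𝓓_{K}(E, F) →L[ℝ] G) (hΦ : ContDiff ℝ ∞ fun p : E' × E => Φ p.1 p.2) :
    ContDiff ℝ ∞ fun y => T (Φ y) := by
  refine contDiff_infty.2 fun n => ?_
  induction n generalizing Φ with
  | zero =>
    have hdiff : Differentiable ℝ fun y => T (Φ y) :=
      fun y => (hasFDerivAt_apply_of_contDiff_uncurry T hΦ y).differentiableAt
    exact contDiff_zero.2 hdiff.continuous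
  | succ n ih =>
    refine contDiff_succ_iff_fderiv_apply.2
      ⟨fun y => (hasFDerivAt_apply_of_contDiff_uncurry T hΦ y).differentiableAt,
        fun hn => absurd hn (WithTop.coe_ne_top (a := (n : ℕ∞))), fun h => ?_⟩
    have hderiv : (fun y => fderiv ℝ (fun y => T (Φ y)) y h) = fun y => T (paramDeriv hΦ y h) := by
      funext y
      rw [(hasFDerivAt_apply_of_contDiff_uncurry T hΦ y).fderiv]
      rfl
    rw [hderiv]
    exact ih (contDiff_uncurry_paramDeriv hΦ h)

end Family

section Precomposition

variable {E F : Type*} [NormedAddCommGroup E] [NormedSpace ℝ E] [NormedAddCommGroup F]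
  [NormedSpace ℝ F] {K L : Compacts E}

/-- Precomposition `f ↦ f ∘ A` with a linear map `A`, as a continuous linear map from the functions
supported in `K` to the functions supported in a compact set `L ⊇ A⁻¹ K`. -/
noncomputable def precompCLM (A : E →L[ℝ] E) (hA : A ⁻¹' K ⊆ L) :
    𝓓_{K}(E, F) →L[ℝ] 𝓓_{L}(E, F) :=
  ContDiffMapSupportedIn.mkCLM ℝ (fun f x => f (A x)) (fun _ _ _ => rfl) (fun _ _ _ => rfl)
    (fun f => f.contDiff.comp A.contDiff)
    (fun f _ hx => f.zero_on_compl fun hAx => hx (hA hAx))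
    fun i _ => by
      refine ⟨{i}, ‖A‖ ^ i, by positivity, fun f x _ => ?_⟩
      calc ‖iteratedFDeriv ℝ i (f ∘ A) x‖
          ≤ ‖iteratedFDeriv ℝ i f (A x)‖ * ∏ _ : Fin i, ‖A‖ := by
            rw [A.iteratedFDeriv_comp_right f.contDiff x (mod_cast le_top)]
            exact ContinuousMultilinearMap.norm_compContinuousLinearMap_le _ _
        _ = ‖A‖ ^ i * ‖iteratedFDeriv ℝ i f (A x)‖ := by simp [mul_comm]
        _ ≤ ‖A‖ ^ i * (({i} : Finset ℕ).sup fun j => N[ℝ]_{K, j}) f := by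
            rw [Finset.sup_singleton]
            gcongr
            exact ContDiffMapSupportedIn.norm_iteratedFDeriv_apply_le_seminorm_top ℝ

end Precomposition

namespace MulConv

variable {𝕜 : Type*} [RCLike 𝕜] {d : ℕ} {T : 𝓓'(nonzeroReals d, 𝕜)} {x y : Fin d → ℝ}
  {A K : Set (Fin d → ℝ)}

theorem mul_mem_nonzeroReals (hx : x ∈ nonzeroReals d) (hy : y ∈ nonzeroReals d) :
    x * y ∈ nonzeroReals d :=
  fun i => mul_ne_zero (hx i) (hy i)

theorem inv_mem_nonzeroReals (hx : x ∈ nonzeroReals d) : x⁻¹ ∈ nonzeroReals d :=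
  fun i => inv_ne_zero (hx i)

theorem inv_mul_cancel_of_mem_nonzeroReals (hx : x ∈ nonzeroReals d) : x⁻¹ * x = 1 :=
  funext fun i => inv_mul_cancel₀ (hx i)

theorem continuousOn_inv_nonzeroReals :
    ContinuousOn (fun x : Fin d → ℝ => x⁻¹) (nonzeroReals d) :=
  continuousOn_pi.2 fun i => (continuous_apply i).continuousOn.inv₀ fun _ hx => hx i

theorem isCompact_image2_inv_mul (hA : IsCompact A) (hAΩ : A ⊆ nonzeroReals d) (hK : IsCompact K) :
    IsCompact (image2 (fun x k => x⁻¹ * k) A K) := by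
  rw [← image_prod]
  refine (hA.prod hK).image_of_continuousOn ?_
  exact ((continuousOn_inv_nonzeroReals.mono hAΩ).comp continuousOn_fst
    fun _ h => h.1).mul continuousOn_snd

theorem image2_inv_mul_subset (hA : A ⊆ nonzeroReals d) (hK : K ⊆ nonzeroReals d) :
    image2 (fun x k => x⁻¹ * k) A K ⊆ nonzeroReals d :=
  image2_subset_iff.2 fun _ hx _ hk => mul_mem_nonzeroReals (inv_mem_nonzeroReals (hA hx)) (hK hk)

/-- `dilate` as a continuous linear map in the test function. -/
noncomputable def dilateCLM (y : nonzeroReals d) :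
    𝓓(nonzeroReals d, ℝ) →L[ℝ] 𝓓(nonzeroReals d, ℝ) :=
  TestFunction.limitCLM ℝ (dilate y)
    (fun K hK => TestFunction.ofSupportedInCLM ℝ
      (K := ⟨dilationHomeo y ⁻¹' K, (dilationHomeo y).isCompact_preimage.2 K.isCompact⟩)
      (fun x hx i hi => hK hx i (by simp [dilationHomeo, hi])) ∘L
      precompCLM ((ContinuousLinearMap.mul ℝ (Fin d → ℝ)).flip y) subset_rfl)
    fun _ _ _ => rfl

theorem exists_apply_dilate_inv_ne_zero (hx : x ∈ support T) {B : Compacts (Fin d → ℝ)}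
    (hB_one : (B : Set (Fin d → ℝ)) ∈ 𝓝 1) (hB : (B : Set (Fin d → ℝ)) ⊆ nonzeroReals d) :
    ∃ f : 𝓓_{B}(Fin d → ℝ, ℝ),
      T (dilate ⟨x⁻¹, inv_mem_nonzeroReals hx.2⟩ (TestFunction.ofSupportedIn hB f)) ≠ 0 := by
  have hcancel := inv_mul_cancel_of_mem_nonzeroReals hx.2
  obtain ⟨u, hu, hTu⟩ := (Distribution.mem_dsupport_iff_forall_exists_ne x).1 hx.1
    ((fun z => z * x⁻¹) ⁻¹' interior B)
    (by simpa [mul_comm x, hcancel] using mem_interior_iff_mem_nhds.2 hB_one)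
    (isOpen_interior.preimage (by fun_prop))
  let f : 𝓓_{B}(Fin d → ℝ, ℝ) :=
    .of_support_subset (dilate ⟨x, hx.2⟩ u).contDiff fun z hz => by
      have h := hu (subset_tsupport u (show z * x ∈ Function.support u from hz))
      rw [mem_preimage, mul_assoc, mul_comm x, hcancel, mul_one] at h
      exact interior_subset h
  refine ⟨f, ?_⟩
  have hf : dilate ⟨x⁻¹, inv_mem_nonzeroReals hx.2⟩ (TestFunction.ofSupportedIn hB f) = u := by
    ext z
    change u (z * x⁻¹ * x) = u z
    rw [mul_assoc, hcancel, mul_one]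
  rwa [hf]

theorem PreservesTestFunctions.exists_isCompact_forall_inv_mem (hT : PreservesTestFunctions T)
    {x : ℕ → Fin d → ℝ} (hx : ∀ n, x n ∈ support T) :
    ∃ L, IsCompact L ∧ L ⊆ nonzeroReals d ∧ ∀ n, (x n)⁻¹ ∈ L := by
  obtain ⟨B, hBc, hB_one, hB⟩ := exists_compact_subset (nonzeroReals d).isOpen
    (show (1 : Fin d → ℝ) ∈ nonzeroReals d from fun _ => one_ne_zero)
  let y (n : ℕ) : nonzeroReals d := ⟨(x n)⁻¹, inv_mem_nonzeroReals (hx n).2⟩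
  let Λ (n : ℕ) : 𝓓_{⟨B, hBc⟩}(Fin d → ℝ, ℝ) →L[ℝ] 𝕜 :=
    (T : 𝓓(nonzeroReals d, ℝ) →L[ℝ] 𝕜) ∘L dilateCLM (y n) ∘L TestFunction.ofSupportedInCLM ℝ hB
  have hΛ (n : ℕ) : Λ n ≠ 0 := by
    obtain ⟨f, hf⟩ := exists_apply_dilate_inv_ne_zero (hx n) (B := ⟨B, hBc⟩)
      (mem_interior_iff_mem_nhds.1 hB_one) hB
    exact fun h => hf (DFunLike.congr_fun h f)
  obtain ⟨g, hg⟩ := exists_forall_apply_ne_zero Λ hΛ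
  obtain ⟨ψ, hψ⟩ := hT (TestFunction.ofSupportedIn hB g)
  exact ⟨tsupport ψ, ψ.hasCompactSupport, ψ.tsupport_subset,
    fun n => subset_tsupport ψ ((hψ (y n)).trans_ne (hg n))⟩

theorem PreservesTestFunctions.isCompact_support (hT : PreservesTestFunctions T) :
    IsCompact (support T) := by
  refine IsSeqCompact.isCompact fun x hx => ?_
  obtain ⟨L, hL, hLΩ, hxL⟩ := hT.exists_isCompact_forall_inv_mem hx
  have hinv : IsCompact ((fun z => z⁻¹) '' L) :=
    hL.image_of_continuousOn (continuousOn_inv_nonzeroReals.mono hLΩ)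
  obtain ⟨a, ⟨b, hb, rfl⟩, s, hs, ha⟩ :=
    hinv.tendsto_subseq fun n => ⟨(x n)⁻¹, hxL n, inv_inv (x n)⟩
  exact ⟨b⁻¹, ⟨Distribution.isClosed_dsupport.mem_of_tendsto ha (.of_forall fun n => (hx _).1),
    inv_mem_nonzeroReals (hLΩ hb)⟩, s, hs, ha⟩

/-- The function `x ↦ η(x) φ(x y)`, supported in `supp η`. Unlike `dilate y φ`, it makes sense for
all `y ∈ ℝ^d`; both agree where `η = 1`. -/
noncomputable def cutoffDilate (η φ : 𝓓(nonzeroReals d, ℝ)) (y : Fin d → ℝ) :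
    𝓓_{⟨tsupport η, η.hasCompactSupport⟩}(Fin d → ℝ, ℝ) :=
  .of_support_subset (f := fun x => η x * φ (x * y))
    (η.contDiff.mul (φ.contDiff.comp (contDiff_id.mul contDiff_const)))
    ((Function.support_mul_subset_left _ _).trans (subset_tsupport η))

theorem contDiff_uncurry_cutoffDilate (η φ : 𝓓(nonzeroReals d, ℝ)) :
    ContDiff ℝ ∞ fun p : (Fin d → ℝ) × (Fin d → ℝ) => cutoffDilate η φ p.1 p.2 :=
  (η.contDiff.comp contDiff_snd).mul (φ.contDiff.comp (contDiff_snd.mul contDiff_fst))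

theorem cutoffDilate_eq_zero (η φ : 𝓓(nonzeroReals d, ℝ))
    (hy : y ∉ image2 (fun x k => x⁻¹ * k) (tsupport η) (tsupport φ)) : cutoffDilate η φ y = 0 := by
  ext x
  by_contra hne
  have hηx : x ∈ tsupport η := subset_tsupport η (left_ne_zero_of_mul hne)
  have hφx : x * y ∈ tsupport φ := subset_tsupport φ (right_ne_zero_of_mul hne)
  refine hy ⟨x, hηx, x * y, hφx, ?_⟩
  change x⁻¹ * (x * y) = y
  rw [← mul_assoc, inv_mul_cancel_of_mem_nonzeroReals (η.tsupport_subset hηx), one_mul]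

theorem PreservesTestFunctions.of_isCompact_support (hT : IsCompact (support T)) :
    PreservesTestFunctions T := by
  intro φ
  obtain ⟨η, hη⟩ := exists_testFunction_one_nhdsSet hT inter_subset_right
  let ψ : (Fin d → ℝ) → 𝕜 := fun y =>
    T (TestFunction.ofSupportedIn η.tsupport_subset (cutoffDilate η φ y))
  have hsmooth : ContDiff ℝ ∞ ψ :=
    contDiff_apply_of_contDiff_uncurry ((T : 𝓓(nonzeroReals d, ℝ) →L[ℝ] 𝕜) ∘L
      TestFunction.ofSupportedInCLM ℝ η.tsupport_subset) (contDiff_uncurry_cutoffDilate η φ)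
  have hcompact : IsCompact (image2 (fun x k => x⁻¹ * k) (tsupport η) (tsupport φ)) :=
    isCompact_image2_inv_mul η.hasCompactSupport η.tsupport_subset φ.hasCompactSupport
  have hsupp : tsupport ψ ⊆ image2 (fun x k => x⁻¹ * k) (tsupport η) (tsupport φ) := by
    refine closure_minimal (fun y hy => by_contra fun hyK => hy ?_) hcompact.isClosed
    change T (TestFunction.ofSupportedInCLM ℝ η.tsupport_subset (cutoffDilate η φ y)) = 0
    rw [cutoffDilate_eq_zero η φ hyK, map_zero, map_zero]
  refine ⟨⟨ψ, hsmooth, hcompact.of_isClosed_subset (isClosed_tsupport ψ) hsupp,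
    hsupp.trans (image2_inv_mul_subset η.tsupport_subset φ.tsupport_subset)⟩, fun y => ?_⟩
  refine apply_eq_of_eventuallyEq_nhdsSet (hη.mono fun x hx => ?_)
  change η x * φ (x * y) = φ (x * y)
  rw [hx, one_mul]

end MulConv

theorem lemma5p1 (𝕜 : Type*) [RCLike 𝕜] (d : ℕ) :
    MulConv.hadamardDistributions 𝕜 d = MulConv.compactlySupported 𝕜 d ∧
    ∀ T : 𝓓'(MulConv.nonzeroReals d, 𝕜),
      MulConv.PreservesTestFunctions T → T ∈ MulConv.compactlySupported 𝕜 d := by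
  refine ⟨Set.Subset.antisymm (fun T hT => hT.1.isCompact_support) fun T hT => ?_,
    fun T hT => hT.isCompact_support⟩
  refine ⟨.of_isCompact_support hT, fun K hK hKΩ => ?_⟩
  have hcompact := MulConv.isCompact_image2_inv_mul hT Set.inter_subset_right hK
  rw [MulConv.IsRelativelyCompactIn, hcompact.isClosed.closure_eq]
  exact ⟨hcompact, MulConv.image2_inv_mul_subset Set.inter_subset_right hKΩ⟩
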